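/- **Setting.** Let $q_0=(0,0)$, $q_1=(1,0)$, $q_2=(\tfrac12,\tfrac{\sqrt3}{2})$ and $F_i(x)=\tfrac12(x+q_i)$ on $\mathbb R^2$. Let $SG$ be the Sierpinski gasket (the nonempty compact set with $SG=\bigcup_i F_i(SG)$), $V_0=\{q_0,q_1,q_2\}$, $V_{n+1}=\bigcup_iF_i(V_n)$, and for $x,y\in V_n$ write $x\sim_n y$ if $x=F_w(q_i)$, $y=F_w(q_j)$ for some word $w$ of length $n$ and some $i\ne j$. Fix a sequence $k_1,k_2,\dots\in\{0,1,2\}$, put $F_{(M)}=F_{k_M}\circ\cdots\circ F_{k_1}$, and let $SG_\infty=\bigcup_M F_{(M)}^{-1}(SG)$ be the infinite Sierpinski gasket. For $m\in\mathbb Z$ let $V_{(m)}=\bigcup_{M+m\ge 0}F_{(M)}^{-1}(V_{M+m})$, let $x\sim_{(m)}y$ mean $F_{(M)}x\sim_{M+m}F_{(M)}y$ for some $M$, and let $\Delta_{(m)}u(x)=\sum_{y\sim_{(m)}x}(u(y)-u(x))$, $\Delta_\infty u(x)=\tfrac32\lim_{m\to\infty}5^m\Delta_{(m)}u(x)$.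 Eigenvalue equations are required at the vertices that are not boundary points of $SG_\infty$ (a boundary point is one that $F_{(M)}$ maps into $V_0$ for all large $M$; there is at most one). **Eigenvalues.** Fix a generation of birth $m_0\in\mathbb Z$, an initial eigenvalue $s\in\{5,6\}$, and an initial function $\varphi$, not identically zero on $V_{(m_0)}$, with $-\Delta_{(m_0)}\varphi=s\varphi$. Let $S$ be the set of eigenvalues $\mu$ of $-\Delta_\infty$ obtained from $\varphi$ by spectral decimation, i.e. those for which there are a continuous $u$ on $SG_\infty$ with $-\Delta_\infty u=\mu u$ and $u=\varphi$ on $V_{(m_0)}$, and numbers $l_0=s,l_1,l_2,\dots$ with $l_{n+1}\in\{\tfrac12(5\pm\sqrt{25-4l_n})\}$ (the sign being $-$ for all but finitely many $n$), $l_{n+1}\notin\{2,5,6\}$, $-\Delta_{(m_0+n)}u=l_nu$ on $V_{(m_0+n)}$ for all $n\ge0$, and $\mu=\tfrac32\lim_n5^{m_0+n}l_n$. Let $\lambda_0<\lambda_1<\lambda_2<\cdots$ be the increasing enumeration either of $S$ or of $S\cup\{0\}$. **Matrices.** For real $\delta,\varepsilon$ let $$M_1=\begin{pmatrix}\delta-\lambda_0&\frac12\varepsilon\\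 \varepsilon&\delta-\lambda_1&\frac12\varepsilon\\ &\frac12\varepsilon&\delta-\lambda_2&\frac12\varepsilon\\ &&\ddots&\ddots&\ddots\end{pmatrix},\qquad M_2=\begin{pmatrix}\delta-\lambda_1&\frac12\varepsilon\\ \frac12\varepsilon&\delta-\lambda_2&\frac12\varepsilon\\ &\frac12\varepsilon&\delta-\lambda_3&\frac12\varepsilon\\ &&\ddots&\ddots&\ddots\end{pmatrix}$$ (Versions 1 and 2 of the fractal Mathieu equation in matrix form). For $i\in\{1,2\}$ let $T_i$ be the set of $(\delta,\varepsilon)\in\mathbb R^2$ for which $M_ic=0$ has a nontrivial solution $c\in\ell^2$. For $k\ge0$, the transition curve number $k$ is the graph of the function $\varepsilon\mapsto\delta(\varepsilon)$ such that, for every $\varepsilon\in\mathbb R$, $(\delta(\varepsilon),\varepsilon)\in T_i$ and there are exactly $k$ numbers $d<\delta(\varepsilon)$ with $(d,\varepsilon)\in T_i$. **Proposition.** For $i=1$ and $i=2$ and every $k\ge0$, the transition curve number $k$ exists, and along it $$\lim_{\varepsilon\to+\infty}\frac{\delta(\varepsilon)}{\varepsilon}=-1,\qquad \lim_{\varepsilon\to-\infty}\frac{\delta(\varepsilon)}{\varepsilon}=1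 .$$ -/

import Mathlib

open Set Filter Topology

noncomputable section

/-! ## The infinite Sierpinski gasket and its graph approximations -/

/-- The Euclidean plane. -/
abbrev Plane : Type := EuclideanSpace ℝ (Fin 2)

/-- The corners `q₀, q₁, q₂` of the Sierpinski gasket. -/
def corner : Fin 3 → Plane :=
  ![!₂[0, 0], !₂[1, 0], !₂[1 / 2, √3 / 2]]

/-- The contraction `F_i` of ratio `1/2` with fixed point `q_i`, that is,
`F₀ x = x/2`, `F₁ x = x/2 + (1/2, 0)`, `F₂ x = x/2 + (1/4, √3/4)`. -/
def contr (i : Fin 3) (x : Plane) : Plane :=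
  (1 / 2 : ℝ) • x + (1 / 2 : ℝ) • corner i

/-- The Sierpinski gasket: the unique nonempty compact set `K` with `K = F₀ K ∪ F₁ K ∪ F₂ K`
(written as the union of all such sets, of which there is exactly one). -/
def sierpinskiGasket : Set Plane :=
  ⋃₀ {K : Set Plane | K.Nonempty ∧ IsCompact K ∧ K = ⋃ i, contr i '' K}

/-- The vertex sets `V₀ = {q₀, q₁, q₂}`, `V_{n+1} = F₀ V_n ∪ F₁ V_n ∪ F₂ V_n`. -/
def gasketVertices : ℕ → Set Plane
  | 0 => range corner
  | n + 1 => ⋃ i, contr i '' gasketVertices n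

/-- `F_w = F_{w₁} ∘ ⋯ ∘ F_{w_n}` for a word `w`. -/
def wordMap : List (Fin 3) → Plane → Plane
  | [] => id
  | i :: w => contr i ∘ wordMap w

/-- The edge relation of the level `n` graph on `V_n`: `x` and `y` are distinct corners of a common
cell of level `n`. -/
def gasketAdj (n : ℕ) (x y : Plane) : Prop :=
  ∃ w : List (Fin 3), w.length = n ∧
    ∃ i j : Fin 3, i ≠ j ∧ x = wordMap w (corner i) ∧ y = wordMap w (corner j)

/-- The map `F_{k_M} ∘ ⋯ ∘ F_{k_1}`, for the sequence `k_{n+1} = κ n`. It carries the piece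
`F_{k_1}⁻¹ ⋯ F_{k_M}⁻¹ SG` of the infinite gasket onto `SG`. -/
def blowMap (κ : ℕ → Fin 3) : ℕ → Plane → Plane
  | 0 => id
  | M + 1 => contr (κ M) ∘ blowMap κ M

/-- The infinite Sierpinski gasket `SG_∞ = ⋃_M F_{k_1}⁻¹ ⋯ F_{k_M}⁻¹ SG`, an increasing union. -/
def infiniteGasket (κ : ℕ → Fin 3) : Set Plane :=
  ⋃ M, blowMap κ M ⁻¹' sierpinskiGasket

/-- The level `m` vertices `V_(m)` of the infinite gasket, `m` an integer. -/
def latticeVertices (κ : ℕ → Fin 3) (m : ℤ) : Set Plane :=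
  {x | ∃ M n : ℕ, (n : ℤ) = M + m ∧ blowMap κ M x ∈ gasketVertices n}

/-- The level `m` edge relation of the infinite gasket (the Sierpinski lattice). -/
def latticeAdj (κ : ℕ → Fin 3) (m : ℤ) (x y : Plane) : Prop :=
  ∃ M n : ℕ, (n : ℤ) = M + m ∧ gasketAdj n (blowMap κ M x) (blowMap κ M y)

/-- The boundary of the infinite gasket: the points that are corners of every sufficiently large
piece. There is at most one such point, and none unless `κ` is eventually constant. -/
def gasketBoundary (κ : ℕ → Fin 3) : Set Plane :=
  {x | ∀ᶠ M in atTop, blowMap κ M x ∈ range corner}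

/-! ## Discrete and continuous Laplacian, spectral decimation -/

/-- The level `m` discrete Laplacian `Δ_(m) u (x) = ∑_{y ∼ x} (u y - u x)`
(a finite sum: a non-boundary vertex has four neighbours). -/
def latticeLaplacian (κ : ℕ → Fin 3) (m : ℤ) (u : Plane → ℝ) (x : Plane) : ℝ :=
  ∑ᶠ (y : Plane) (_ : latticeAdj κ m x y), (u y - u x)

/-- `-Δ_(m) u = μ u` at all the non-boundary vertices of level `m`. -/
def IsLatticeEigenfunction (κ : ℕ → Fin 3) (m : ℤ) (u : Plane → ℝ) (μ : ℝ) : Prop :=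
  ∀ x ∈ latticeVertices κ m \ gasketBoundary κ, -latticeLaplacian κ m u x = μ * u x

/-- `-Δ_∞ u = μ u` on the infinite gasket, where `Δ_∞ u = (3/2) lim 5^m Δ_(m) u` at the
non-boundary vertices and `u` is continuous. -/
def IsGasketEigenfunction (κ : ℕ → Fin 3) (u : Plane → ℝ) (μ : ℝ) : Prop :=
  ContinuousOn u (infiniteGasket κ) ∧
    ∀ x ∈ (⋃ m : ℤ, latticeVertices κ m) \ gasketBoundary κ,
      Tendsto (fun m : ℕ => 3 / 2 * 5 ^ m * latticeLaplacian κ m u x) atTop (𝓝 (-(μ * u x)))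

/-- The two inverse branches of `x ↦ x (5 - x)`. -/
def psiMinus (x : ℝ) : ℝ := (5 - √(25 - 4 * x)) / 2

/-- See `psiMinus`. -/
def psiPlus (x : ℝ) : ℝ := (5 + √(25 - 4 * x)) / 2

/-- A sequence `l 0, l 1, …` of discrete eigenvalues (of the levels `m₀, m₀ + 1, …`) produced by the
spectral decimation algorithm from the initial eigenvalue `s`: each term arises from the previous
one by one of the two branches, all but finitely many times by the lower one, and the forbidden
values `2, 5, 6` do not occur after the start (so that the first step from `6` is `psiPlus`). -/
structure IsDecimationSequence (s : ℝ) (l : ℕ → ℝ) : Prop where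
  start : l 0 = s
  step : ∀ n, l (n + 1) = psiMinus (l n) ∨ l (n + 1) = psiPlus (l n)
  eventually_minus : ∀ᶠ n in atTop, l (n + 1) = psiMinus (l n)
  not_forbidden : ∀ n, l (n + 1) ≠ 2 ∧ l (n + 1) ≠ 5 ∧ l (n + 1) ≠ 6

/-- The eigenvalues `μ = (3/2) lim 5^m λ_m` of `-Δ_∞` whose eigenfunction `u` is obtained by
spectral decimation from the initial function `φ` on `V_(m₀)`, where `m₀` is the generation of birth
and `s` the initial eigenvalue: `u` extends `φ`, and on each `V_(m₀ + n)` it is an eigenfunction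
of the discrete Laplacian with the decimated eigenvalue. -/
def decimationEigenvalues (κ : ℕ → Fin 3) (m₀ : ℤ) (s : ℝ) (φ : Plane → ℝ) : Set ℝ :=
  {μ | ∃ (u : Plane → ℝ) (l : ℕ → ℝ),
    IsGasketEigenfunction κ u μ ∧
    EqOn u φ (latticeVertices κ m₀) ∧
    IsDecimationSequence s l ∧
    (∀ n : ℕ, IsLatticeEigenfunction κ (m₀ + n) u (l n)) ∧
    Tendsto (fun n : ℕ => 3 / 2 * (5 : ℝ) ^ (m₀ + n) * l n) atTop (𝓝 μ)}

/-! ## The fractal Mathieu equation in matrix form -/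

/-- The infinite matrix `M₁` of Version 1, with rows and columns numbered from `0`. -/
def mathieuOne (lam : ℕ → ℝ) (δ ε : ℝ) : Matrix ℕ ℕ ℝ := fun i j =>
  if i = j then δ - lam i
  else if j = i + 1 then ε / 2
  else if i = j + 1 then (if j = 0 then ε else ε / 2)
  else 0

/-- The infinite matrix `M₂` of Version 2; its diagonal starts with `δ - λ₁`. -/
def mathieuTwo (lam : ℕ → ℝ) (δ ε : ℝ) : Matrix ℕ ℕ ℝ := fun i j =>
  if i = j then δ - lam (i + 1)
  else if j = i + 1 ∨ i = j + 1 then ε / 2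
  else 0

/-- The equation `M c = 0` has a nontrivial solution `c` in `ℓ²`.
(The rows of the matrices considered here are finitely supported.) -/
def HasNontrivialSolution (M : Matrix ℕ ℕ ℝ) : Prop :=
  ∃ c : lp (fun _ : ℕ => ℝ) 2, c ≠ 0 ∧ ∀ i, ∑' j, M i j * c j = 0

/-- The points `(δ, ε)` that make up the transition curves. -/
def transitionPoints (M : ℝ → ℝ → Matrix ℕ ℕ ℝ) : Set (ℝ × ℝ) :=
  {p | HasNontrivialSolution (M p.1 p.2)}

/-- The graph `{(δ ε, ε)}` is the transition curve number `k` (counted from `0`): for every `ε`,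
the point `(δ ε, ε)` lies on the transition curves, and exactly `k` such points with the same `ε`
have a smaller first coordinate. -/
def IsTransitionCurve (M : ℝ → ℝ → Matrix ℕ ℕ ℝ) (k : ℕ) (δ : ℝ → ℝ) : Prop :=
  ∀ ε : ℝ, (δ ε, ε) ∈ transitionPoints M ∧
    {d : ℝ | d < δ ε ∧ (d, ε) ∈ transitionPoints M}.encard = k

end

open scoped InnerProductSpace

/-! Both matrix equations say that `δ` is an eigenvalue of `Λ - ε J` on `ℓ²`, where `Λ` is diagonal
with strictly increasing entries tending to infinity and `J` is a bounded symmetric Jacobi matrix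
with weights `w₀, 1/2, 1/2, …`; Version 1 becomes symmetric after rescaling one coordinate. The
entries tend to infinity because an upper decimation step at a late level makes the eigenvalue large
(`finite_decimationEigenvalues_inter_Iic`).

Existence: `Λ - ε J` has compact resolvent, hence an eigenbasis; its eigenvalues are simple,
infinite in number and finite in number below any bound, so they can be counted from the bottom.

Asymptotics: the quadratic form of `J` is bounded by `‖f‖ ^ 2`, so every eigenvalue is at least `a 0
- |ε|`. Conversely, `k + 1` disjoint blocks with `q + 1` constant entries each span a space on which
the form of `J` is `q / (q + 1)` times the squared norm and `Λ` is bounded independently of `ε`. By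
min-max, curve `k` lies below `C - |ε| * (q / (q + 1))`; the sign of `ε` is irrelevant by
conjugation with `(-1)ⁿ`. Divide by `|ε|`, then let `q` grow. -/

/-! ### Spectral decimation: finitely many eigenvalues below any bound -/

theorem psiMinus_nonneg {x : ℝ} (hx : 0 ≤ x) : 0 ≤ psiMinus x := by
  have h : √(25 - 4 * x) ≤ 5 := by
    rw [Real.sqrt_le_left (by norm_num)]; linarith
  unfold psiMinus; linarith

theorem psiMinus_le (x : ℝ) : psiMinus x ≤ 5 / 2 := by
  have := Real.sqrt_nonneg (25 - 4 * x)
  unfold psiMinus; linarith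

theorem le_psiPlus (x : ℝ) : 5 / 2 ≤ psiPlus x := by
  have := Real.sqrt_nonneg (25 - 4 * x)
  unfold psiPlus; linarith

theorem psiPlus_le {x : ℝ} (hx : 0 ≤ x) : psiPlus x ≤ 5 := by
  have h : √(25 - 4 * x) ≤ 5 := by
    rw [Real.sqrt_le_left (by norm_num)]; linarith
  unfold psiPlus; linarith

/-- The square root lies below its tangent at `0`, the line `5 - 2 / 5 * x`. This makes `5 ^ n * l
n` nondecreasing along lower steps. -/
theorem le_five_mul_psiMinus {x : ℝ} (hx : 0 ≤ x) (hx' : x ≤ 25 / 4) : x ≤ 5 * psiMinus x := by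
  have h : √(25 - 4 * x) ≤ 5 - 2 / 5 * x := by
    rw [Real.sqrt_le_left (by linarith)]; nlinarith
  unfold psiMinus; linarith

namespace IsDecimationSequence

variable {s : ℝ} {l : ℕ → ℝ}

theorem mem_Icc (h : IsDecimationSequence s l) (hs : s = 5 ∨ s = 6) (n : ℕ) :
    l n ∈ Icc (0 : ℝ) 6 := by
  induction n with
  | zero => rw [h.start]; rcases hs with rfl | rfl <;> norm_num
  | succ n ih =>
    rcases h.step n with e | e <;> rw [e]
    · exact ⟨psiMinus_nonneg ih.1, (psiMinus_le _).trans (by norm_num)⟩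
    · exact ⟨le_trans (by norm_num) (le_psiPlus _), (psiPlus_le ih.1).trans (by norm_num)⟩

theorem le_five_mul_succ (h : IsDecimationSequence s l) (hs : s = 5 ∨ s = 6) (n : ℕ) :
    l n ≤ 5 * l (n + 1) := by
  have hn := h.mem_Icc hs n
  rcases h.step n with e | e <;> rw [e]
  · exact le_five_mul_psiMinus hn.1 (hn.2.trans (by norm_num))
  · linarith [le_psiPlus (l n), hn.2]

theorem monotone_renormalized (h : IsDecimationSequence s l) (hs : s = 5 ∨ s = 6) (m₀ : ℤ) :
    Monotone fun n : ℕ => 3 / 2 * (5 : ℝ) ^ (m₀ + n) * l n := by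
  refine monotone_nat_of_le_succ fun n => ?_
  have e : (5 : ℝ) ^ (m₀ + ((n + 1 : ℕ) : ℤ)) = 5 ^ (m₀ + (n : ℤ)) * 5 := by
    rw [← zpow_add_one₀ (by norm_num)]; push_cast; congr 1; ring
  have h0 : (0 : ℝ) < 5 ^ (m₀ + (n : ℤ)) := by positivity
  have := mul_le_mul_of_nonneg_left (h.le_five_mul_succ hs n) h0.le
  simp only [e]
  linarith

theorem eq_of_upper_steps_eq {l' : ℕ → ℝ} (h : IsDecimationSequence s l)
    (h' : IsDecimationSequence s l')
    (he : {n | l (n + 1) ≠ psiMinus (l n)} = {n | l' (n + 1) ≠ psiMinus (l' n)}) : l = l' := by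
  funext n
  induction n with
  | zero => rw [h.start, h'.start]
  | succ n ih =>
    have hn := Set.ext_iff.1 he n
    simp only [mem_ofPred_eq] at hn
    have h1 := h.step n
    have h2 := h'.step n
    rw [ih] at h1 hn
    grind

end IsDecimationSequence

/-- An upper step `n` forces the eigenvalue to be at least of order `5 ^ n`, so that below a given
bound there are only finitely many eigenvalues. -/
theorem finite_decimationEigenvalues_inter_Iic (κ : ℕ → Fin 3) (m₀ : ℤ) {s : ℝ}
    (hs : s = 5 ∨ s = 6) (φ : Plane → ℝ) (C : ℝ) :
    (decimationEigenvalues κ m₀ s φ ∩ Iic C).Finite := by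
  obtain ⟨N, hN⟩ : ∃ N : ℕ, ∀ n : ℕ, N ≤ n →
      C < 3 / 2 * (5 : ℝ) ^ (m₀ + ((n + 1 : ℕ) : ℤ)) * (5 / 2) := by
    have h5 : (0 : ℝ) < 5 ^ m₀ := by positivity
    obtain ⟨N, hN⟩ := pow_unbounded_of_one_lt (C / 5 ^ m₀) (by norm_num : (1 : ℝ) < 5)
    refine ⟨N, fun n hn => ?_⟩
    rw [div_lt_iff₀ h5] at hN
    rw [zpow_add₀ (by norm_num), zpow_natCast]
    have h1 : (5 : ℝ) ^ N ≤ 5 ^ (n + 1) := pow_le_pow_right₀ (by norm_num) (by omega)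
    have h2 := mul_le_mul_of_nonneg_left h1 h5.le
    have h3 : (0 : ℝ) < 5 ^ m₀ * 5 ^ N := by positivity
    linarith
  -- A sequence is determined by its set of upper steps, so only finitely many have all of them
  -- before `N`. An upper step at `n ≥ N` would push the limit, which dominates every renormalized
  -- term, beyond `C`.
  set D : Set (ℕ → ℝ) :=
    {l | IsDecimationSequence s l ∧ {n | l (n + 1) ≠ psiMinus (l n)} ⊆ Iio N}
  have hD : D.Finite := by
    refine Set.Finite.of_finite_image (f := fun l => {n | l (n + 1) ≠ psiMinus (l n)})
      ((finite_Iio N).finite_subsets.subset ?_) ?_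
    · rintro _ ⟨l, hl, rfl⟩
      exact hl.2
    · intro l hl l' hl' he
      exact hl.1.eq_of_upper_steps_eq hl'.1 he
  refine (hD.image fun l => limUnder atTop
    (fun n : ℕ => 3 / 2 * (5 : ℝ) ^ (m₀ + n) * l n)).subset ?_
  rintro μ ⟨⟨u, l, -, -, hl, -, hμ⟩, hC⟩
  refine ⟨l, ⟨hl, fun n hn => ?_⟩, hμ.limUnder_eq⟩
  by_contra hNn
  have hlow : 5 / 2 ≤ l (n + 1) := by
    rcases hl.step n with e | e
    · exact absurd e hn
    · rw [e]; exact le_psiPlus _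
  have h1 := (hl.monotone_renormalized hs m₀).ge_of_tendsto hμ (n + 1)
  have h2 := hN n (not_lt.1 hNn)
  have h0 : (0 : ℝ) < 5 ^ (m₀ + ((n + 1 : ℕ) : ℤ)) := by positivity
  have h3 := mul_le_mul_of_nonneg_left hlow h0.le
  have h4 : μ ≤ C := hC
  linarith

/-! ### Counting in sets with finite lower sections -/

theorem tendsto_atTop_of_finite_inter_Iic {S : Set ℝ} (hS : ∀ C, (S ∩ Iic C).Finite)
    {f : ℕ → ℝ} (hf : StrictMono f) (hfS : ∀ n, f n ∈ S) : Tendsto f atTop atTop := by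
  refine tendsto_atTop_atTop_of_monotone hf.monotone fun C => ?_
  by_contra! h
  refine Set.infinite_range_of_injective hf.injective ((hS C).subset ?_)
  rintro _ ⟨n, rfl⟩
  exact ⟨hfS n, (h n).le⟩

theorem exists_mem_encard_lt_eq {E : Set ℝ} (hE : E.Infinite) (hfin : ∀ x, (E ∩ Iic x).Finite)
    (k : ℕ) : ∃ d ∈ E, {d' | d' < d ∧ d' ∈ E}.encard = k := by
  have key : ∀ F ⊆ E, F.Nonempty → ∃ d ∈ F, ∀ d' ∈ F, d ≤ d' := by
    rintro F hF ⟨x, hx⟩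
    obtain ⟨d, hd, hmin⟩ := ((hfin x).subset (inter_subset_inter_left (Iic x) hF)).exists_minimal
      ⟨x, hx, mem_Iic.2 le_rfl⟩
    refine ⟨d, hd.1, fun d' hd' => ?_⟩
    rcases le_total d' x with h | h
    · rcases le_total d d' with h' | h'
      · exact h'
      · exact hmin ⟨hd', h⟩ h'
    · exact le_trans hd.2 h
  induction k with
  | zero =>
    obtain ⟨d, hd, hmin⟩ := key E le_rfl hE.nonempty
    refine ⟨d, hd, ?_⟩
    rw [Nat.cast_zero, Set.encard_eq_zero, Set.eq_empty_iff_forall_notMem]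
    rintro d' ⟨h1, h2⟩
    exact absurd (hmin d' h2) (not_le.2 h1)
  | succ k ih =>
    obtain ⟨d, hd, hk⟩ := ih
    -- The element following `d` is the least element of `E` above `d`.
    obtain ⟨d', hd', hmin⟩ := key (E \ (E ∩ Iic d)) sdiff_subset (hE.sdiff (hfin d)).nonempty
    have hlt : d < d' := not_le.1 fun h => hd'.2 ⟨hd'.1, h⟩
    refine ⟨d', hd'.1, ?_⟩
    have : {x | x < d' ∧ x ∈ E} = insert d {x | x < d ∧ x ∈ E} := by
      ext x
      simp only [mem_ofPred_eq, mem_insert_iff]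
      constructor
      · rintro ⟨h1, h2⟩
        by_cases hx : x ≤ d
        · rcases hx.eq_or_lt with h | h
          · exact Or.inl h
          · exact Or.inr ⟨h, h2⟩
        · exact absurd (hmin x ⟨h2, fun h => hx h.2⟩) (not_le.2 h1)
      · rintro (rfl | ⟨h1, h2⟩)
        · exact ⟨hlt, hd⟩
        · exact ⟨h1.trans hlt, h2⟩
    rw [this, Set.encard_insert_of_notMem (by simp), hk]
    norm_cast

/-! ### Weighted shifts and diagonal operators on `ℓ²` -/

/-- The Hilbert space `ℓ²(ℕ)`. -/
abbrev SqSummable : Type := lp (fun _ : ℕ => ℝ) 2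

namespace SqSummable

theorem memℓp_two_iff {f : ℕ → ℝ} : Memℓp f 2 ↔ Summable fun n => f n ^ 2 := by
  rw [memℓp_gen_iff (by norm_num)]
  simp

theorem hasSum_mul (f g : SqSummable) : HasSum (fun n => f n * g n) ⟪f, g⟫_ℝ := by
  simpa [mul_comm] using lp.hasSum_inner (𝕜 := ℝ) f g

theorem hasSum_sq (f : SqSummable) : HasSum (fun n => f n ^ 2) (‖f‖ ^ 2) := by
  simpa [sq] using hasSum_mul f f

theorem norm_sq_eq (f : SqSummable) : ‖f‖ ^ 2 = ∑' n, f n ^ 2 := (hasSum_sq f).tsum_eq.symm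

theorem inner_single (n : ℕ) (f : SqSummable) : ⟪lp.single 2 n (1 : ℝ), f⟫_ℝ = f n := by
  simpa using lp.inner_single_left (𝕜 := ℝ) n (1 : ℝ) f

theorem weightedComp_aux {w : ℕ → ℝ} {C : ℝ} (hw : ∀ n, |w n| ≤ C) {σ : ℕ → ℕ}
    (hσ : σ.Injective) (f : SqSummable) :
    Summable (fun n => (w n * f (σ n)) ^ 2) ∧ ∑' n, (w n * f (σ n)) ^ 2 ≤ C ^ 2 * ‖f‖ ^ 2 := by
  have hC : 0 ≤ C := (abs_nonneg _).trans (hw 0)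
  have hle : ∀ n, (w n * f (σ n)) ^ 2 ≤ C ^ 2 * f (σ n) ^ 2 := fun n => by
    rw [mul_pow]
    exact mul_le_mul_of_nonneg_right (sq_le_sq.2 (by rw [abs_of_nonneg hC]; exact hw n))
      (sq_nonneg _)
  have hs := (hasSum_sq f).summable
  have hs' : Summable fun n => C ^ 2 * f (σ n) ^ 2 := (hs.comp_injective hσ).mul_left _
  have h1 := Summable.of_nonneg_of_le (fun n => sq_nonneg _) hle hs'
  refine ⟨h1, (h1.tsum_le_tsum hle hs').trans ?_⟩
  rw [tsum_mul_left, norm_sq_eq]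
  refine mul_le_mul_of_nonneg_left ?_ (sq_nonneg _)
  exact tsum_comp_le_tsum_of_inj hs (fun n => sq_nonneg _) hσ

/-- The bounded operator `f ↦ (w n * f (σ n))ₙ` for bounded weights `w` and injective `σ`. -/
noncomputable def weightedComp (w : ℕ → ℝ) (C : ℝ) (hw : ∀ n, |w n| ≤ C) (σ : ℕ → ℕ)
    (hσ : σ.Injective) : SqSummable →L[ℝ] SqSummable :=
  LinearMap.mkContinuous
    { toFun := fun f => ⟨fun n => w n * f (σ n),
        memℓp_two_iff.2 (weightedComp_aux hw hσ f).1⟩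
      map_add' := fun f g => by ext n; exact mul_add _ _ _
      map_smul' := fun r f => by ext n; simp [mul_left_comm] }
    C fun f => by
      have hC : 0 ≤ C := (abs_nonneg _).trans (hw 0)
      refine abs_le_of_sq_le_sq' ?_ (by positivity) |>.2
      rw [norm_sq_eq, mul_pow]
      exact (weightedComp_aux hw hσ f).2

variable {w : ℕ → ℝ} {C : ℝ} {hw : ∀ n, |w n| ≤ C} {σ : ℕ → ℕ} {hσ : σ.Injective}

@[simp] theorem weightedComp_apply (f : SqSummable) (n : ℕ) :
    weightedComp w C hw σ hσ f n = w n * f (σ n) := rfl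

theorem norm_weightedComp_le : ‖weightedComp w C hw σ hσ‖ ≤ C :=
  LinearMap.mkContinuous_norm_le _ ((abs_nonneg _).trans (hw 0)) _

theorem isSelfAdjoint_weightedComp_id :
    IsSelfAdjoint (weightedComp w C hw id Function.injective_id) := by
  rw [ContinuousLinearMap.isSelfAdjoint_iff_isSymmetric]
  intro f g
  refine (hasSum_mul _ g).unique ?_
  convert! hasSum_mul f _ using 2 with n
  simp [mul_left_comm, mul_assoc]

/-- A diagonal operator whose entries tend to `0` is compact. -/
theorem isCompactOperator_weightedComp_id (hw0 : Tendsto w atTop (𝓝 0)) :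
    IsCompactOperator (weightedComp w C hw id Function.injective_id) := by
  -- Finite-rank truncations; the remainder is again diagonal, with norm at most the supremum of the
  -- tail of `w`.
  let P : ℕ → SqSummable →L[ℝ] SqSummable := fun N =>
    ∑ n ∈ Finset.range N, (innerSL ℝ (lp.single 2 n (w n) : SqSummable)).smulRight
      (lp.single 2 n (1 : ℝ) : SqSummable)
  have hP : ∀ N f n, P N f n = if n < N then w n * f n else 0 := by
    intro N f n
    simp only [P, _root_.sum_apply, ContinuousLinearMap.smulRight_apply,
      innerSL_apply_apply, lp.inner_single_left, lp.coeFn_sum, Finset.sum_apply, lp.coeFn_smul,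
      Pi.smul_apply, lp.coeFn_single, Pi.single_apply]
    simp [mul_comm]
  have hPc : ∀ N, IsCompactOperator (P N) := by
    intro N
    refine Submodule.sum_mem (compactOperator (RingHom.id ℝ) SqSummable SqSummable) fun n _ => ?_
    exact (isCompactOperator_of_locallyCompactSpace_rng
      (ContinuousLinearMap.toSpanSingleton ℝ (lp.single 2 n (1 : ℝ) : SqSummable))).comp_clm
        (innerSL ℝ (lp.single 2 n (w n) : SqSummable))
  refine isCompactOperator_of_tendsto (F := P) (l := atTop) ?_ (Eventually.of_forall hPc)
  rw [Metric.tendsto_atTop]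
  intro η hη
  obtain ⟨N, hN⟩ := Metric.tendsto_atTop.1 hw0 (η / 2) (half_pos hη)
  refine ⟨N, fun m hm => ?_⟩
  have hb : ∀ n, |(if n < m then 0 else - w n)| ≤ η / 2 := by
    intro n
    split_ifs with h
    · rw [abs_zero]; exact (half_pos hη).le
    · have := hN n (by omega)
      rw [Real.dist_eq, sub_zero] at this
      rw [abs_neg]; exact this.le
  have he : P m - weightedComp w C hw id Function.injective_id =
      weightedComp _ (η / 2) hb id Function.injective_id := by
    ext f n
    simp only [_root_.sub_apply, lp.coeFn_sub, Pi.sub_apply, hP, weightedComp_apply,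
      id]
    split_ifs <;> simp
  rw [dist_eq_norm, he]
  exact norm_weightedComp_le.trans_lt (half_lt_self hη)

end SqSummable

/-! ### The free Jacobi operator and its quadratic form -/

/-- Off-diagonal weights `w₀, 1/2, 1/2, …` with `0 < w₀ ≤ 1/√2`. -/
structure IsMathieuWeight (w : ℕ → ℝ) : Prop where
  zero_pos : 0 < w 0
  zero_sq_le : w 0 ^ 2 ≤ 1 / 2
  succ : ∀ n, w (n + 1) = 1 / 2

namespace IsMathieuWeight

variable {w : ℕ → ℝ}

theorem pos (h : IsMathieuWeight w) (n : ℕ) : 0 < w n := by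
  cases n with
  | zero => exact h.zero_pos
  | succ n => rw [h.succ]; norm_num

theorem abs_le_one (h : IsMathieuWeight w) (n : ℕ) : |w n| ≤ 1 := by
  rw [abs_of_pos (h.pos n)]
  cases n with
  | zero => nlinarith [h.zero_sq_le]
  | succ n => rw [h.succ]; norm_num

end IsMathieuWeight

open SqSummable

/-- The bounded Jacobi operator with zero diagonal and off-diagonal entries `w`. -/
noncomputable def freeJacobi {w : ℕ → ℝ} (hw : IsMathieuWeight w) :
    SqSummable →L[ℝ] SqSummable :=
  weightedComp w 1 hw.abs_le_one Nat.succ Nat.succ_injective +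
    ContinuousLinearMap.adjoint
      (weightedComp w 1 hw.abs_le_one Nat.succ Nat.succ_injective)

section FreeJacobi

variable {w : ℕ → ℝ} (hw : IsMathieuWeight w)

theorem freeJacobi_apply (f : SqSummable) (n : ℕ) :
    freeJacobi hw f n = w n * f (n + 1) + ⟪weightedComp w 1 hw.abs_le_one Nat.succ
      Nat.succ_injective (lp.single 2 n (1 : ℝ)), f⟫_ℝ := by
  rw [← ContinuousLinearMap.adjoint_inner_right, inner_single]
  rfl

@[simp] theorem freeJacobi_apply_zero (f : SqSummable) :
    freeJacobi hw f 0 = w 0 * f 1 := by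
  rw [freeJacobi_apply]
  have : weightedComp w 1 hw.abs_le_one Nat.succ Nat.succ_injective
      (lp.single 2 0 (1 : ℝ)) = 0 := by
    ext n; simp
  simp [this]

@[simp] theorem freeJacobi_apply_succ (f : SqSummable) (n : ℕ) :
    freeJacobi hw f (n + 1) = w (n + 1) * f (n + 2) + w n * f n := by
  rw [freeJacobi_apply]
  have : weightedComp w 1 hw.abs_le_one Nat.succ Nat.succ_injective
      (lp.single 2 (n + 1) (1 : ℝ)) = lp.single 2 n (w n) := by
    ext m
    by_cases h : m = n <;> simp [h]
  rw [this, lp.inner_single_left]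
  simp [mul_comm]

theorem isSelfAdjoint_freeJacobi : IsSelfAdjoint (freeJacobi hw) :=
  IsSelfAdjoint.add_star_self _

theorem inner_freeJacobi_left (f g : SqSummable) :
    ⟪freeJacobi hw f, g⟫_ℝ = ⟪f, freeJacobi hw g⟫_ℝ :=
  (isSelfAdjoint_freeJacobi hw).isSymmetric f g

theorem hasSum_inner_freeJacobi_self (f : SqSummable) :
    HasSum (fun n => 2 * (w n * f n * f (n + 1))) ⟪freeJacobi hw f, f⟫_ℝ := by
  have h := (hasSum_mul (weightedComp w 1 hw.abs_le_one Nat.succ Nat.succ_injective f) f).mul_left 2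
  have e : ⟪freeJacobi hw f, f⟫_ℝ =
      2 * ⟪weightedComp w 1 hw.abs_le_one Nat.succ Nat.succ_injective f, f⟫_ℝ := by
    rw [freeJacobi, _root_.add_apply, inner_add_left, ContinuousLinearMap.adjoint_inner_left,
      real_inner_comm, two_mul]
  rw [e]
  convert! h using 2 with n
  simp; ring

/-- Each edge term is split by Young's inequality so that the shares at every site add up to one:
site `0` gives its full mass to its only edge, every other site half to each side. On edge `0` this
reads `|2 w₀ f₀ f₁| ≤ f₀² + w₀² f₁²`, whence the condition `w₀² ≤ 1/2`. The constant `1` is what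
gives the slope in the final limit. -/
theorem abs_inner_freeJacobi_self_le (f : SqSummable) :
    |⟪freeJacobi hw f, f⟫_ℝ| ≤ ‖f‖ ^ 2 := by
  let p : ℕ → ℝ := fun n => if n = 0 then 1 else 1 / 2
  have hs := hasSum_sq f
  have h1 : Summable fun n => p n * f n ^ 2 :=
    Summable.of_nonneg_of_le (fun n => by simp only [p]; split_ifs <;> positivity)
      (fun n => by simp only [p]; split_ifs <;> nlinarith [sq_nonneg (f n)]) hs.summable
  have h2 : Summable fun n => (1 - p n) * f n ^ 2 := by
    simpa [sub_mul] using hs.summable.sub h1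
  have h3 : HasSum (fun n => p n * f n ^ 2 + (1 - p (n + 1)) * f (n + 1) ^ 2) (‖f‖ ^ 2) := by
    have h4 := h1.hasSum.add ((summable_nat_add_iff 1).2 h2).hasSum
    have e : ∑' n, p n * f n ^ 2 + ∑' n, (1 - p (n + 1)) * f (n + 1) ^ 2 = ‖f‖ ^ 2 := by
      have e1 := h2.tsum_eq_zero_add
      have e2 : (1 - p 0) * f 0 ^ 2 = 0 := by simp [p]
      rw [e2, zero_add] at e1
      rw [← e1, ← h1.tsum_add h2, norm_sq_eq]
      congr 1; ext n; ring
    rwa [e] at h4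
  have hterm : ∀ n, |2 * (w n * f n * f (n + 1))| ≤
      p n * f n ^ 2 + (1 - p (n + 1)) * f (n + 1) ^ 2 := by
    intro n
    rw [abs_le]
    rcases n with _ | n
    · have := hw.zero_sq_le
      simp only [p]
      norm_num
      constructor <;>
        nlinarith [sq_nonneg (f 0 + w 0 * f 1), sq_nonneg (f 0 - w 0 * f 1), sq_nonneg (f 1),
          mul_le_mul_of_nonneg_right this (sq_nonneg (f 1))]
    · rw [hw.succ]
      simp only [p]
      norm_num
      constructor <;> nlinarith [sq_nonneg (f (n + 1) + f (n + 1 + 1)),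
        sq_nonneg (f (n + 1) - f (n + 1 + 1))]
  have h5 := hasSum_inner_freeJacobi_self hw f
  rw [abs_le]
  constructor
  · exact hasSum_le (fun n => (abs_le.1 (hterm n)).1) h3.neg h5
  · exact hasSum_le (fun n => (abs_le.1 (hterm n)).2) h5 h3

end FreeJacobi

/-! ### Eigenvectors: lower bound, orthogonality, simplicity -/

/-- `f` solves `(d - Λ + ε J) f = 0`, where `Λ` is diagonal with entries `a` and `J` is the free
Jacobi operator with weights `w`. -/
def IsJacobiSolution (a : ℕ → ℝ) {w : ℕ → ℝ} (hw : IsMathieuWeight w) (ε d : ℝ)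
    (f : SqSummable) : Prop :=
  ∀ n, (d - a n) * f n + ε * freeJacobi hw f n = 0

/-- The eigenvalues of the Jacobi operator `Λ - ε J`. -/
def jacobiEigenvalues (a : ℕ → ℝ) {w : ℕ → ℝ} (hw : IsMathieuWeight w) (ε : ℝ) : Set ℝ :=
  {d | ∃ f, f ≠ 0 ∧ IsJacobiSolution a hw ε d f}

namespace IsJacobiSolution

variable {a w : ℕ → ℝ} {hw : IsMathieuWeight w} {ε d d' : ℝ} {f g : SqSummable}

theorem sub (hf : IsJacobiSolution a hw ε d f) (hg : IsJacobiSolution a hw ε d g) :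
    IsJacobiSolution a hw ε d (f - g) := fun n => by
  have h1 := hf n
  have h2 := hg n
  simp only [map_sub, lp.coeFn_sub, Pi.sub_apply]
  linarith

theorem smul (hf : IsJacobiSolution a hw ε d f) (r : ℝ) :
    IsJacobiSolution a hw ε d (r • f) := fun n => by
  have h1 := hf n
  simp only [map_smul, lp.coeFn_smul, Pi.smul_apply, smul_eq_mul]
  linear_combination r * h1

theorem hasSum_quadratic (hf : IsJacobiSolution a hw ε d f) :
    HasSum (fun n => (a n - d) * f n ^ 2) (ε * ⟪freeJacobi hw f, f⟫_ℝ) := by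
  convert! (hasSum_mul (freeJacobi hw f) f).mul_left ε using 2 with n
  linear_combination (-f n) * hf n

theorem lower_bound (hf : IsJacobiSolution a hw ε d f) (hf0 : f ≠ 0) {B : ℝ}
    (ha : ∀ n, B ≤ a n) : B - |ε| ≤ d := by
  have hpos : 0 < ‖f‖ ^ 2 := by positivity
  have h1 := hasSum_le (fun n => mul_le_mul_of_nonneg_right (sub_le_sub_right (ha n) d)
    (sq_nonneg (f n))) ((hasSum_sq f).mul_left (B - d)) hf.hasSum_quadratic
  have h2 : ε * ⟪freeJacobi hw f, f⟫_ℝ ≤ |ε| * ‖f‖ ^ 2 := by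
    refine (le_abs_self _).trans ?_
    rw [abs_mul]
    exact mul_le_mul_of_nonneg_left (abs_inner_freeJacobi_self_le hw f) (abs_nonneg _)
  have h3 := le_of_mul_le_mul_right (h1.trans h2) hpos
  linarith

/-- The unbounded diagonal cancels coordinatewise in `(d - d') f g = ε (f Jg - Jf g)`, so only the
symmetry of the bounded `J` is needed. -/
theorem inner_eq_zero (hf : IsJacobiSolution a hw ε d f) (hg : IsJacobiSolution a hw ε d' g)
    (hd : d ≠ d') : ⟪f, g⟫_ℝ = 0 := by
  have h1 := (hasSum_mul f g).mul_left (d - d')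
  have h2 := ((hasSum_mul f (freeJacobi hw g)).mul_left ε).sub
    ((hasSum_mul (freeJacobi hw f) g).mul_left ε)
  rw [inner_freeJacobi_left, sub_self] at h2
  have h3 : (fun n => (d - d') * (f n * g n)) = fun n =>
      ε * (f n * freeJacobi hw g n) - ε * (freeJacobi hw f n * g n) := by
    funext n
    linear_combination g n * hf n - f n * hg n
  rw [h3] at h1
  exact (mul_eq_zero.1 (h1.unique h2)).resolve_left (sub_ne_zero.2 hd)

end IsJacobiSolution

/-- Solutions are determined by the value at a suitable index. -/
theorem exists_index_determining_jacobiSolution {a w : ℕ → ℝ} (ha : StrictMono a)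
    (hw : IsMathieuWeight w) (ε d : ℝ) :
    ∃ m, ∀ f, IsJacobiSolution a hw ε d f → f m = 0 → f = 0 := by
  -- For `ε = 0` a solution is supported on the at most one index with `a m = d`; otherwise the
  -- three-term recurrence determines it from `f 0`.
  by_cases hε : ε = 0
  · subst hε
    have key : ∀ f, IsJacobiSolution a hw 0 d f → ∀ n, d ≠ a n → f n = 0 := by
      intro f hf n hn
      have := hf n
      rw [zero_mul, add_zero] at this
      exact (mul_eq_zero.1 this).resolve_left (sub_ne_zero.2 hn)
    by_cases hm : ∃ m, d = a m
    · obtain ⟨m, rfl⟩ := hm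
      refine ⟨m, fun f hf h0 => ?_⟩
      ext n
      by_cases hnm : n = m
      · rw [hnm, h0]; rfl
      · exact key f hf n fun h => hnm (ha.injective h.symm)
    · push Not at hm
      exact ⟨0, fun f hf _ => by ext n; exact key f hf n (hm n)⟩
  · refine ⟨0, fun f hf h0 => ?_⟩
    have h : ∀ n, f n = 0 ∧ f (n + 1) = 0 := by
      intro n
      induction n with
      | zero =>
        refine ⟨h0, ?_⟩
        have := hf 0
        rw [h0, freeJacobi_apply_zero] at this
        simpa [hε, (hw.pos 0).ne'] using this
      | succ n ih =>
        refine ⟨ih.2, ?_⟩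
        have := hf (n + 1)
        rw [ih.2, freeJacobi_apply_succ, ih.1] at this
        simpa [hε, (hw.pos (n + 1)).ne'] using this
    ext n
    exact (h n).1

theorem IsJacobiSolution.exists_smul_eq {a w : ℕ → ℝ} {hw : IsMathieuWeight w} {ε d : ℝ}
    (ha : StrictMono a) {f g : SqSummable} (hf : IsJacobiSolution a hw ε d f) (hf0 : f ≠ 0)
    (hg : IsJacobiSolution a hw ε d g) : ∃ r : ℝ, g = r • f := by
  obtain ⟨m, hm⟩ := exists_index_determining_jacobiSolution ha hw ε d
  have hfm : f m ≠ 0 := fun h => hf0 (hm f hf h)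
  refine ⟨g m / f m, sub_eq_zero.1 (hm _ (hg.sub (hf.smul _)) ?_)⟩
  rw [lp.coeFn_sub, lp.coeFn_smul, Pi.sub_apply, Pi.smul_apply, smul_eq_mul,
    div_mul_cancel₀ _ hfm, sub_self]

theorem norm_freeJacobi_le {w : ℕ → ℝ} (hw : IsMathieuWeight w) : ‖freeJacobi hw‖ ≤ 2 := by
  refine (norm_add_le _ _).trans ?_
  rw [LinearIsometryEquiv.norm_map]
  linarith [norm_weightedComp_le (hw := hw.abs_le_one) (hσ := Nat.succ_injective)]

/-! ### Compact resolvent, eigenbasis, discreteness -/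

/-- A compact self-adjoint resolvent of the Jacobi operator `Λ - ε J`. -/
theorem exists_compact_resolvent {a w : ℕ → ℝ} (ha : Monotone a) (hat : Tendsto a atTop atTop)
    (hw : IsMathieuWeight w) (ε : ℝ) :
    ∃ (K : SqSummable →L[ℝ] SqSummable) (t : ℝ), IsCompactOperator K ∧ K.IsSymmetric ∧
      (∀ f, K f = 0 → f = 0) ∧
      ∀ f κ, κ ≠ 0 → K f = κ • f → IsJacobiSolution a hw ε (1 / κ - t) f := by
  -- With this shift, `R = (Λ + t)⁻¹` satisfies `‖ε J R‖ ≤ 2|ε| / (2|ε| + 1) < 1`. Hence `U = 1 - ε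
  -- J R` is invertible, `Λ + t - ε J` factors as `U (Λ + t)`, and its inverse is `R U⁻¹`.
  obtain ⟨t, hlow⟩ : ∃ t, ∀ n, 2 * |ε| + 1 ≤ a n + t :=
    ⟨2 * |ε| + 1 - a 0, fun n => by linarith [ha (Nat.zero_le n)]⟩
  have hpos0 : 0 < 2 * |ε| + 1 := by positivity
  have hpos : ∀ n, 0 < a n + t := fun n => hpos0.trans_le (hlow n)
  have hr : ∀ n, |(a n + t)⁻¹| ≤ (2 * |ε| + 1)⁻¹ := fun n => by
    rw [abs_of_pos (inv_pos.2 (hpos n))]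
    exact inv_anti₀ hpos0 (hlow n)
  set R := weightedComp (fun n => (a n + t)⁻¹) _ hr id Function.injective_id with hR
  set J := freeJacobi hw with hJ
  have hRs : star R = R := isSelfAdjoint_weightedComp_id
  have hJs : star J = J := isSelfAdjoint_freeJacobi hw
  have hRinj : ∀ f, R f = 0 → f = 0 := fun f hf => by
    ext n
    have : R f n = 0 := by rw [hf]; rfl
    rw [hR, weightedComp_apply] at this
    exact (mul_eq_zero.1 this).resolve_left (inv_pos.2 (hpos n)).ne'
  have hnorm : ‖ε • (J * R)‖ < 1 := by
    rw [norm_smul]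
    have h1 : ‖J * R‖ ≤ 2 * (2 * |ε| + 1)⁻¹ := (norm_mul_le _ _).trans
      (mul_le_mul (norm_freeJacobi_le hw) norm_weightedComp_le (norm_nonneg _) (by norm_num))
    refine (mul_le_mul_of_nonneg_left h1 (norm_nonneg _)).trans_lt ?_
    rw [Real.norm_eq_abs, ← mul_assoc, ← div_eq_mul_inv, div_lt_one hpos0]
    linarith
  obtain ⟨U, hU⟩ := isUnit_one_sub_of_norm_lt_one hnorm
  -- Both sides equal `R - ε R J R`; this identity makes `R U⁻¹` self-adjoint.
  have hUs : star (U : SqSummable →L[ℝ] SqSummable) * R = R * U := by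
    rw [hU, star_sub, star_smul, star_mul, hRs, hJs, star_one, star_trivial]
    simp [sub_mul, mul_sub, mul_assoc]
  refine ⟨R * (↑U⁻¹ : SqSummable →L[ℝ] SqSummable), t, ?_, ?_, ?_, ?_⟩
  · have hRc : IsCompactOperator R := isCompactOperator_weightedComp_id
      (tendsto_inv_atTop_zero.comp (tendsto_atTop_add_const_right _ _ hat))
    exact hRc.comp_clm _
  · rw [← ContinuousLinearMap.isSelfAdjoint_iff_isSymmetric, isSelfAdjoint_iff, star_mul, hRs]
    have h1 : star (↑U⁻¹ : SqSummable →L[ℝ] SqSummable) *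
        star (U : SqSummable →L[ℝ] SqSummable) = 1 := by
      rw [← star_mul, Units.mul_inv, star_one]
    calc star (↑U⁻¹ : SqSummable →L[ℝ] SqSummable) * R
        = star (↑U⁻¹ : SqSummable →L[ℝ] SqSummable) *
            (R * U * (↑U⁻¹ : SqSummable →L[ℝ] SqSummable)) := by
          rw [mul_assoc R, Units.mul_inv, mul_one]
      _ = R * (↑U⁻¹ : SqSummable →L[ℝ] SqSummable) := by
          rw [← hUs, mul_assoc, ← mul_assoc, h1, one_mul]
  · intro f hf
    have h1 := hRinj _ hf
    have h2 : (U * (↑U⁻¹ : SqSummable →L[ℝ] SqSummable)) f = 0 :=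
      (congrArg (U : SqSummable →L[ℝ] SqSummable) h1).trans (map_zero _)
    rwa [Units.mul_inv] at h2
  · intro f κ hκ hf n
    set y := (↑U⁻¹ : SqSummable →L[ℝ] SqSummable) f with hy
    have hRy : R y = κ • f := hf
    have h2 : f = y - ε • J (R y) := by
      have : f = (U * (↑U⁻¹ : SqSummable →L[ℝ] SqSummable)) f := by rw [Units.mul_inv]; rfl
      rw [this]
      change (U : SqSummable →L[ℝ] SqSummable) y = _
      rw [hU]; rfl
    have h3 := congrArg (fun g : SqSummable => g n) h2
    have h4 := congrArg (fun g : SqSummable => g n) hRy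
    rw [hRy] at h3
    simp only [hR, weightedComp_apply, id, lp.coeFn_smul, lp.coeFn_sub, Pi.smul_apply,
      Pi.sub_apply, map_smul, smul_eq_mul] at h3 h4
    have h5 := (hpos n).ne'
    have h6 : y n = (a n + t) * (κ * f n) := by
      rw [← h4]; field_simp
    rw [h6] at h3
    rw [← hJ]
    field_simp
    linear_combination h3

/-- Eigenvectors of the Jacobi operator, one for each eigenvalue, form a Hilbert basis. -/
theorem exists_hilbertBasis_jacobiSolution {a w : ℕ → ℝ} (ha : StrictMono a)
    (hat : Tendsto a atTop atTop) (hw : IsMathieuWeight w) (ε : ℝ) :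
    ∃ b : HilbertBasis (jacobiEigenvalues a hw ε) ℝ SqSummable,
      ∀ d : jacobiEigenvalues a hw ε, IsJacobiSolution a hw ε d (b d) := by
  choose e he0 he using fun d : jacobiEigenvalues a hw ε => d.2
  let v : jacobiEigenvalues a hw ε → SqSummable := fun d => ‖e d‖⁻¹ • e d
  have hv : ∀ d : jacobiEigenvalues a hw ε, IsJacobiSolution a hw ε d (v d) :=
    fun d => (he d).smul _
  have hvo : Orthonormal ℝ v := by
    refine ⟨fun d => ?_, fun d d' h => (hv d).inner_eq_zero (hv d') fun h' => h (Subtype.ext h')⟩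
    rw [norm_smul, norm_inv, norm_norm, inv_mul_cancel₀ (norm_ne_zero_iff.2 (he0 d))]
  obtain ⟨K, t, hKc, hKs, hK0, hK⟩ := exists_compact_resolvent ha.monotone hat hw ε
  -- The eigenspaces of the compact self-adjoint `K` are total. Injectivity of `K` excludes the
  -- eigenvalue `0`, and by simplicity every eigenvector is a multiple of some `v d`.
  have hbot : (Submodule.span ℝ (range v))ᗮ = ⊥ := by
    rw [eq_bot_iff, ← K.orthogonalComplement_iSup_eigenspaces_eq_bot hKc hKs]
    refine Submodule.orthogonal_le (iSup_le fun κ f hf => ?_)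
    rw [Module.End.mem_eigenspace_iff] at hf
    have hf' : K f = κ • f := hf
    by_cases hf0 : f = 0
    · rw [hf0]; exact zero_mem _
    · have hκ : κ ≠ 0 := by
        rintro rfl
        exact hf0 (hK0 f (by rw [hf', zero_smul]))
      have hs := hK f κ hκ hf'
      let d : jacobiEigenvalues a hw ε := ⟨_, f, hf0, hs⟩
      have hv0 : v d ≠ 0 := hvo.ne_zero d
      obtain ⟨r, hr⟩ := (hv d).exists_smul_eq ha hv0 hs
      rw [hr]
      exact Submodule.smul_mem _ _ (Submodule.subset_span (mem_range_self d))
  refine ⟨HilbertBasis.mkOfOrthogonalEqBot hvo hbot, fun d => ?_⟩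
  rw [HilbertBasis.coe_mkOfOrthogonalEqBot]
  exact hv d

/-- Below any bound there are only finitely many eigenvalues. -/
theorem finite_jacobiEigenvalues_inter_Iic {a w : ℕ → ℝ} (ha : StrictMono a)
    (hat : Tendsto a atTop atTop) (hw : IsMathieuWeight w) (ε x : ℝ) :
    (jacobiEigenvalues a hw ε ∩ Iic x).Finite := by
  obtain ⟨b, hb⟩ := exists_hilbertBasis_jacobiSolution ha hat hw ε
  obtain ⟨N, hN⟩ := eventually_atTop.1 (hat.eventually_ge_atTop (x + |ε| + 1))
  set B : ℝ := |x + |ε| - a 0| with hB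
  have hB0 : 0 ≤ B := abs_nonneg _
  -- An eigenvector with eigenvalue at most `x` cannot live where the potential exceeds `x + |ε| +
  -- 1`: it keeps mass at least `1 / (1 + B)` on the first `N` sites. By Bessel's inequality an
  -- orthonormal family has total mass at most `N` there, so at most `(1 + B) * N` such eigenvalues
  -- exist.
  have key : ∀ d : jacobiEigenvalues a hw ε, (d : ℝ) ≤ x →
      1 ≤ (1 + B) * ∑ n ∈ Finset.range N, b d n ^ 2 := by
    intro d hd
    have hn : ‖b d‖ = 1 := b.orthonormal.1 d
    have h1 := (hb d).hasSum_quadratic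
    have h2 := hasSum_sq (b d)
    have h3 : HasSum (fun n => if n < N then (1 + B) * b d n ^ 2 else 0)
        (∑ n ∈ Finset.range N, if n < N then (1 + B) * b d n ^ 2 else 0) :=
      hasSum_sum_of_ne_finset_zero fun n hn => if_neg (by simpa using hn)
    have hle : ∀ n, b d n ^ 2 ≤ (if n < N then (1 + B) * b d n ^ 2 else 0) +
        ((a n - d) * b d n ^ 2 - |ε| * b d n ^ 2) := by
      intro n
      have hsq := sq_nonneg (b d n)
      split_ifs with h
      · have h5 : 0 ≤ B + (a n - d) - |ε| := by
          linarith [neg_abs_le (x + |ε| - a 0), le_abs_self (x + |ε| - a 0),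
            ha.monotone (Nat.zero_le n)]
        nlinarith [mul_nonneg h5 hsq]
      · have h5 : 0 ≤ (a n - d) - |ε| - 1 := by linarith [hN n (not_lt.1 h)]
        nlinarith [mul_nonneg h5 hsq]
    have h4 := hasSum_le hle h2 (h3.add (h1.sub (h2.mul_left |ε|)))
    have h6 : ε * ⟪freeJacobi hw (b d), b d⟫_ℝ ≤ |ε| := by
      refine (le_abs_self _).trans ?_
      rw [abs_mul]
      have := abs_inner_freeJacobi_self_le hw (b d)
      rw [hn] at this
      nlinarith [abs_nonneg ε]
    rw [hn] at h4
    have h7 : ∑ n ∈ Finset.range N, (if n < N then (1 + B) * b d n ^ 2 else 0) =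
        (1 + B) * ∑ n ∈ Finset.range N, b d n ^ 2 := by
      rw [Finset.mul_sum]
      exact Finset.sum_congr rfl fun n hn => if_pos (Finset.mem_range.1 hn)
    rw [h7] at h4
    linarith
  have hcard : ∀ F : Finset (jacobiEigenvalues a hw ε), (∀ d ∈ F, (d : ℝ) ≤ x) →
      (F.card : ℝ) ≤ (1 + B) * N := by
    intro F hF
    calc (F.card : ℝ) = ∑ d ∈ F, (1 : ℝ) := by simp
      _ ≤ ∑ d ∈ F, (1 + B) * ∑ n ∈ Finset.range N, b d n ^ 2 :=
        Finset.sum_le_sum fun d hd => key d (hF d hd)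
      _ = (1 + B) * ∑ n ∈ Finset.range N, ∑ d ∈ F, b d n ^ 2 := by
        rw [← Finset.mul_sum, Finset.sum_comm]
      _ ≤ (1 + B) * ∑ n ∈ Finset.range N, (1 : ℝ) := by
        refine mul_le_mul_of_nonneg_left (Finset.sum_le_sum fun n _ => ?_) (by positivity)
        have := b.orthonormal.sum_inner_products_le (lp.single 2 n (1 : ℝ)) (s := F)
        rw [lp.norm_single (by norm_num)] at this
        simpa [real_inner_comm, inner_single] using this
      _ = (1 + B) * N := by simp
  have hfin : {d : jacobiEigenvalues a hw ε | (d : ℝ) ≤ x}.Finite := by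
    by_contra hinf
    obtain ⟨m, hm⟩ := exists_nat_gt ((1 + B) * N)
    obtain ⟨F, hF, hFc⟩ := Set.Infinite.exists_subset_card_eq hinf m
    have := hcard F fun d hd => hF hd
    rw [hFc] at this
    linarith
  refine (hfin.image Subtype.val).subset ?_
  rintro d ⟨hd, hx⟩
  exact ⟨⟨d, hd⟩, hx, rfl⟩

/-! ### Min-max with block test vectors -/

section Rayleigh

variable {a w : ℕ → ℝ} {hw : IsMathieuWeight w} {ε : ℝ}

/-- A test vector `v` whose Rayleigh quotient is at most `x` is not orthogonal to all the
eigenvectors with eigenvalue at most `x`. Here `g` is the vector `Λ v`. -/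
theorem exists_inner_ne_zero_of_rayleigh_le
    (b : HilbertBasis (jacobiEigenvalues a hw ε) ℝ SqSummable)
    (hb : ∀ d : jacobiEigenvalues a hw ε, IsJacobiSolution a hw ε d (b d))
    {v g : SqSummable} (hg : ∀ n, g n = a n * v n) (hv : v ≠ 0) {x : ℝ}
    (hx : ⟪g, v⟫_ℝ - ε * ⟪freeJacobi hw v, v⟫_ℝ ≤ x * ‖v‖ ^ 2) :
    ∃ d : jacobiEigenvalues a hw ε, (d : ℝ) ≤ x ∧ ⟪b d, v⟫_ℝ ≠ 0 := by
  by_contra! h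
  have hAb : ∀ d : jacobiEigenvalues a hw ε,
      ⟪g - ε • freeJacobi hw v, b d⟫_ℝ = d * ⟪b d, v⟫_ℝ := by
    intro d
    rw [inner_sub_left, real_inner_smul_left, inner_freeJacobi_left]
    refine ((hasSum_mul g (b d)).sub ((hasSum_mul v (freeJacobi hw (b d))).mul_left ε)).unique ?_
    convert! (hasSum_mul (b d) v).mul_left (d : ℝ) using 2 with n
    rw [hg]
    linear_combination (-v n) * hb d n
  have h1 : HasSum (fun d : jacobiEigenvalues a hw ε => (d : ℝ) * ⟪b d, v⟫_ℝ ^ 2)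
      (⟪g, v⟫_ℝ - ε * ⟪freeJacobi hw v, v⟫_ℝ) := by
    have := b.hasSum_inner_mul_inner (g - ε • freeJacobi hw v) v
    rw [inner_sub_left, real_inner_smul_left] at this
    convert! this using 2 with d
    rw [hAb]; ring
  have h2 : HasSum (fun d : jacobiEigenvalues a hw ε => ⟪b d, v⟫_ℝ ^ 2) (‖v‖ ^ 2) := by
    have := b.hasSum_inner_mul_inner v v
    rw [real_inner_self_eq_norm_sq] at this
    convert! this using 2 with d
    rw [real_inner_comm, sq]
  -- The series of `(d - x) ⟪b d, v⟫²` has nonnegative terms and a sum at most `0`. So all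
  -- coefficients vanish and `v = 0`; this covers equality in the Rayleigh bound too.
  have h3 := h1.sub (h2.mul_left x)
  have hnn : ∀ d : jacobiEigenvalues a hw ε,
      0 ≤ (d : ℝ) * ⟪b d, v⟫_ℝ ^ 2 - x * ⟪b d, v⟫_ℝ ^ 2 := by
    intro d
    rcases le_or_gt (d : ℝ) x with hd | hd
    · simp [h d hd]
    · rw [← sub_mul]; exact mul_nonneg (sub_nonneg.2 hd.le) (sq_nonneg _)
  have h4 : ⟪g, v⟫_ℝ - ε * ⟪freeJacobi hw v, v⟫_ℝ - x * ‖v‖ ^ 2 = 0 :=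
    le_antisymm (sub_nonpos.2 hx) (h3.nonneg hnn)
  rw [h4, hasSum_zero_iff_of_nonneg hnn] at h3
  have h5 : ∀ d, ⟪b d, v⟫_ℝ = 0 := by
    intro d
    rcases le_or_gt (d : ℝ) x with hd | hd
    · exact h d hd
    · have := congrFun h3 d
      simp only [Pi.zero_apply, ← sub_mul] at this
      exact pow_eq_zero_iff two_ne_zero |>.1
        ((mul_eq_zero.1 this).resolve_left (sub_pos.2 hd).ne')
  simp only [h5, ne_eq, two_ne_zero, not_false_eq_true, zero_pow] at h2
  have h6 := h2.unique hasSum_zero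
  exact hv (by simpa using h6)

end Rayleigh

/-- The function that is constant equal to `α i` on the interior of the `i`-th block of length `L`,
and vanishes at the left endpoints of the blocks. -/
noncomputable def blockFun (L k : ℕ) (α : Fin k → ℝ) (n : ℕ) : ℝ :=
  if h : n / L < k ∧ n % L ≠ 0 then α ⟨n / L, h.1⟩ else 0

theorem blockFun_eq_zero {L k : ℕ} (hL : 0 < L) (α : Fin k → ℝ) {n : ℕ} (hn : k * L ≤ n) :
    blockFun L k α n = 0 :=
  dif_neg fun h => absurd h.1 (not_lt.2 ((Nat.le_div_iff_mul_le hL).2 hn))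

theorem blockFun_left {L k : ℕ} (α : Fin k → ℝ) (i : ℕ) : blockFun L k α (i * L) = 0 :=
  dif_neg fun h => h.2 (Nat.mul_mod_left i L)

theorem blockFun_interior {L k : ℕ} (α : Fin k → ℝ) (i : Fin k) {j : ℕ} (hj0 : j ≠ 0)
    (hj : j < L) : blockFun L k α (i * L + j) = α i := by
  have h1 : (i * L + j) / L = i := by
    rw [mul_comm, Nat.mul_add_div (by omega), Nat.div_eq_of_lt hj, add_zero]
  have h2 : (i * L + j) % L = j := by
    rw [mul_comm, Nat.mul_add_mod, Nat.mod_eq_of_lt hj]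
  rw [blockFun, dif_pos ⟨by rw [h1]; exact i.2, by rw [h2]; exact hj0⟩]
  congr 1
  exact Fin.ext h1

/-- `blockFun` as a linear map into `ℓ²`. -/
noncomputable def blockVector (L k : ℕ) (hL : 0 < L) : (Fin k → ℝ) →ₗ[ℝ] SqSummable where
  toFun α := ⟨blockFun L k α, memℓp_two_iff.2 <|
    summable_of_ne_finset_zero (s := Finset.range (k * L)) fun n hn => by
      rw [blockFun_eq_zero hL α (by simpa using hn)]; simp⟩
  map_add' α β := by
    ext n
    change blockFun L k (α + β) n = blockFun L k α n + blockFun L k β n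
    unfold blockFun
    split_ifs <;> simp
  map_smul' r α := by
    ext n
    change blockFun L k (r • α) n = r * blockFun L k α n
    unfold blockFun
    split_ifs <;> simp

theorem sum_range_mul_eq (f : ℕ → ℝ) (k L : ℕ) :
    ∑ n ∈ Finset.range (k * L), f n =
      ∑ i : Fin k, ∑ j ∈ Finset.range L, f (i * L + j) := by
  rw [Fin.sum_univ_eq_sum_range (fun i => ∑ j ∈ Finset.range L, f (i * L + j))]
  induction k with
  | zero => simp
  | succ k ih => rw [Finset.sum_range_succ, ← ih, add_mul, one_mul, Finset.sum_range_add]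

section Block

variable {q k : ℕ} (α : Fin k → ℝ)

theorem norm_sq_blockVector :
    ‖blockVector (q + 2) k (by omega) α‖ ^ 2 = (q + 1) * ∑ i, α i ^ 2 := by
  refine (hasSum_sq _).unique ?_
  have h : ∑ n ∈ Finset.range (k * (q + 2)), blockFun (q + 2) k α n ^ 2 =
      (q + 1) * ∑ i, α i ^ 2 := by
    rw [sum_range_mul_eq, Finset.mul_sum]
    refine Finset.sum_congr rfl fun i _ => ?_
    rw [Finset.sum_range_succ', add_zero, blockFun_left]
    rw [Finset.sum_congr rfl fun j hj => by
      rw [blockFun_interior α i (Nat.succ_ne_zero j) (by simpa using hj)]]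
    simp
  rw [← h]
  refine hasSum_sum_of_ne_finset_zero fun n hn => ?_
  change blockFun (q + 2) k α n ^ 2 = 0
  rw [blockFun_eq_zero (by omega) α (by simpa using hn)]; simp

/-- Each block has `q` interior edges of weight `1/2`, counted twice by symmetry. The zeros at the
left endpoints decouple neighbouring blocks and remove edge `0`, the only one whose weight may
differ from `1/2`. -/
theorem inner_freeJacobi_blockVector {w : ℕ → ℝ} (hw : IsMathieuWeight w) :
    ⟪freeJacobi hw (blockVector (q + 2) k (by omega) α), blockVector (q + 2) k (by omega) α⟫_ℝ =
      q * ∑ i, α i ^ 2 := by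
  refine (hasSum_inner_freeJacobi_self hw _).unique ?_
  have h : ∑ n ∈ Finset.range (k * (q + 2)),
      2 * (w n * blockFun (q + 2) k α n * blockFun (q + 2) k α (n + 1)) =
        q * ∑ i, α i ^ 2 := by
    rw [sum_range_mul_eq, Finset.mul_sum]
    refine Finset.sum_congr rfl fun i _ => ?_
    rw [Finset.sum_range_succ', add_zero, blockFun_left, Finset.sum_range_succ]
    have e : (i : ℕ) * (q + 2) + (q + 1) + 1 = (i + 1) * (q + 2) := by ring
    rw [e, blockFun_left]
    rw [Finset.sum_congr rfl fun j hj => by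
      have hj' := Finset.mem_range.1 hj
      rw [add_assoc (_ * _) (j + 1) 1, blockFun_interior α i (Nat.succ_ne_zero j) (by omega),
        blockFun_interior α i (Nat.succ_ne_zero (j + 1)) (by omega), ← add_assoc, hw.succ]]
    simp [sq]
    left; ring
  rw [← h]
  refine hasSum_sum_of_ne_finset_zero fun n hn => ?_
  change 2 * (w n * blockFun (q + 2) k α n * blockFun (q + 2) k α (n + 1)) = 0
  rw [blockFun_eq_zero (by omega) α (by simpa using hn)]; simp

end Block

/-- Upper bound for the number of eigenvalues by means of block test vectors. -/
theorem le_encard_jacobiEigenvalues_inter_Iic {a w : ℕ → ℝ} (ha : StrictMono a)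
    (hat : Tendsto a atTop atTop) (hw : IsMathieuWeight w) (ε : ℝ) (k q : ℕ) :
    (k : ℕ∞) ≤
      (jacobiEigenvalues a hw ε ∩ Iic (a (k * (q + 2)) - ε * (q / (q + 1)))).encard := by
  obtain ⟨b, hb⟩ := exists_hilbertBasis_jacobiSolution ha hat hw ε
  set x := a (k * (q + 2)) - ε * (q / (q + 1)) with hx
  let S : Set (jacobiEigenvalues a hw ε) := {d | (d : ℝ) ≤ x}
  have hS : jacobiEigenvalues a hw ε ∩ Iic x = Subtype.val '' S := by
    ext d
    constructor
    · rintro ⟨hd, hdx⟩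
      exact ⟨⟨d, hd⟩, hdx, rfl⟩
    · rintro ⟨d, hd, rfl⟩
      exact ⟨d.2, hd⟩
  have hSfin : S.Finite := by
    refine Set.Finite.of_finite_image ?_ Subtype.val_injective.injOn
    rw [← hS]
    exact finite_jacobiEigenvalues_inter_Iic ha hat hw ε x
  rw [hS, Subtype.val_injective.encard_image]
  by_contra! hlt
  have := hSfin.fintype
  -- If fewer than `k` eigenvalues were at most `x`, some nonzero block vector would be orthogonal
  -- to all their eigenvectors, although its Rayleigh quotient is at most `x`.
  let Φ : (Fin k → ℝ) →ₗ[ℝ] (S → ℝ) := LinearMap.pi fun d =>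
    (innerSL ℝ (b d.1)).toLinearMap ∘ₗ blockVector (q + 2) k (by omega)
  have hker : LinearMap.ker Φ ≠ ⊥ := by
    refine LinearMap.ker_ne_bot_of_finrank_lt ?_
    rw [Module.finrank_fintype_fun_eq_card, Module.finrank_fintype_fun_eq_card, Fintype.card_fin]
    rw [← Set.coe_fintypeCard] at hlt
    exact_mod_cast hlt
  obtain ⟨α, hα, hα0⟩ := Submodule.exists_mem_ne_zero_of_ne_bot hker
  set v := blockVector (q + 2) k (by omega) α
  have hαpos : 0 < ∑ i, α i ^ 2 := by
    obtain ⟨i, hi⟩ := Function.ne_iff.1 hα0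
    exact Finset.sum_pos' (fun i _ => sq_nonneg _) ⟨i, Finset.mem_univ _, by
      simp at hi; positivity⟩
  have hnorm : ‖v‖ ^ 2 = (q + 1) * ∑ i, α i ^ 2 := norm_sq_blockVector α
  have hinner : ⟪freeJacobi hw v, v⟫_ℝ = q * ∑ i, α i ^ 2 := inner_freeJacobi_blockVector α hw
  have hv0 : v ≠ 0 := by
    intro h
    rw [h, norm_zero] at hnorm
    have : 0 < ((q : ℝ) + 1) * ∑ i, α i ^ 2 := by positivity
    linarith
  have hvz : ∀ n, k * (q + 2) ≤ n → v n = 0 := fun n hn => blockFun_eq_zero (by omega) α hn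
  let g : SqSummable := ⟨fun n => a n * v n, memℓp_two_iff.2 <|
    summable_of_ne_finset_zero (s := Finset.range (k * (q + 2))) fun n hn => by
      rw [hvz n (by simpa using hn)]; simp⟩
  have hgv : ⟪g, v⟫_ℝ ≤ a (k * (q + 2)) * ‖v‖ ^ 2 := by
    refine hasSum_le (fun n => ?_) (hasSum_mul g v) ((hasSum_sq v).mul_left _)
    change a n * v n * v n ≤ _
    rcases le_total (k * (q + 2)) n with h | h
    · rw [hvz n h]; simp
    · nlinarith [mul_le_mul_of_nonneg_right (ha.monotone h) (sq_nonneg (v n))]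
  obtain ⟨d, hd, hne⟩ := exists_inner_ne_zero_of_rayleigh_le b hb (v := v) (g := g) (fun n => rfl)
    hv0 (x := x) (by
      have h1 : x * ‖v‖ ^ 2 = a (k * (q + 2)) * ‖v‖ ^ 2 - ε * (q * ∑ i, α i ^ 2) := by
        rw [hx, hnorm]; field_simp
      rw [h1, hinner]
      linarith)
  exact hne (congrFun (LinearMap.mem_ker.1 hα) ⟨d, hd⟩)

theorem infinite_jacobiEigenvalues {a w : ℕ → ℝ} (ha : StrictMono a)
    (hat : Tendsto a atTop atTop) (hw : IsMathieuWeight w) (ε : ℝ) :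
    (jacobiEigenvalues a hw ε).Infinite := by
  intro hfin
  have h1 := le_encard_jacobiEigenvalues_inter_Iic ha hat hw ε (hfin.toFinset.card + 1) 0
  have h2 := h1.trans (Set.encard_le_encard inter_subset_left)
  rw [hfin.encard_eq_coe_toFinset_card] at h2
  have h3 : hfin.toFinset.card + 1 ≤ hfin.toFinset.card := by exact_mod_cast h2
  omega

/-! ### Sign symmetry and asymptotic slopes -/

/-- Conjugation with the signs `(-1)ⁿ` exchanges `ε` and `-ε`. -/
theorem jacobiEigenvalues_neg_subset (a : ℕ → ℝ) {w : ℕ → ℝ} (hw : IsMathieuWeight w) (ε : ℝ) :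
    jacobiEigenvalues a hw ε ⊆ jacobiEigenvalues a hw (-ε) := by
  rintro d ⟨f, hf0, hf⟩
  let T := weightedComp (fun n => (-1 : ℝ) ^ n) 1 (by simp) id Function.injective_id
  refine ⟨T f, fun h => hf0 ?_, fun n => ?_⟩
  · ext n
    have : T f n = 0 := by rw [h]; rfl
    simpa [T] using this
  · have hn := hf n
    cases n with
    | zero =>
      simp only [freeJacobi_apply_zero, T, weightedComp_apply, id] at hn ⊢
      linear_combination hn
    | succ n =>
      simp only [freeJacobi_apply_succ, T, weightedComp_apply, id] at hn ⊢
      rw [pow_succ (-1 : ℝ) (n + 1), pow_succ (-1 : ℝ) n]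
      linear_combination (-(-1 : ℝ) ^ n) * hn

theorem jacobiEigenvalues_neg (a : ℕ → ℝ) {w : ℕ → ℝ} (hw : IsMathieuWeight w) (ε : ℝ) :
    jacobiEigenvalues a hw (-ε) = jacobiEigenvalues a hw ε := by
  refine Subset.antisymm ?_ (jacobiEigenvalues_neg_subset a hw ε)
  simpa using jacobiEigenvalues_neg_subset a hw (-ε)

theorem jacobiEigenvalues_abs (a : ℕ → ℝ) {w : ℕ → ℝ} (hw : IsMathieuWeight w) (ε : ℝ) :
    jacobiEigenvalues a hw |ε| = jacobiEigenvalues a hw ε := by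
  rcases abs_choice ε with h | h <;> rw [h]
  exact jacobiEigenvalues_neg a hw ε

/-- For fixed `q` the upper bound gives a limsup of at most `-q / (q + 1)`; `q` is chosen only after
the target `y > -1`, so `C` may depend on it. -/
theorem tendsto_div_neg_one {ι : Type*} {l : Filter ι} {ρ r : ι → ℝ} (hr : Tendsto r l atTop)
    {B : ℝ} (hlow : ∀ i, B - r i ≤ ρ i)
    (hup : ∀ q : ℕ, ∃ C, ∀ i, ρ i ≤ C - r i * (q / (q + 1))) :
    Tendsto (fun i => ρ i / r i) l (𝓝 (-1)) := by
  have hlim : ∀ C y : ℝ, Tendsto (fun i => C / r i - y) l (𝓝 (-y)) := fun C y => by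
    simpa using (hr.const_div_atTop C).sub_const y
  rw [tendsto_order]
  constructor
  · intro y hy
    filter_upwards [(tendsto_order.1 (hlim B 1)).1 y hy, hr.eventually_gt_atTop 0] with i hi hpos
    refine hi.trans_le ?_
    rw [div_sub_one hpos.ne']
    exact div_le_div_of_nonneg_right (hlow i) hpos.le
  · intro y hy
    obtain ⟨q, hq⟩ := exists_nat_one_div_lt (show 0 < y + 1 by linarith)
    obtain ⟨C, hC⟩ := hup q
    have hq1 : (q : ℝ) / (q + 1) = 1 - 1 / (q + 1) := by field_simp; ring
    filter_upwards [(tendsto_order.1 (hlim C (q / (q + 1)))).2 y (by rw [hq1]; linarith),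
      hr.eventually_gt_atTop 0] with i hi hpos
    refine lt_of_le_of_lt ?_ hi
    have h := div_le_div_of_nonneg_right (hC i) hpos.le
    rwa [sub_div, mul_div_cancel_left₀ _ hpos.ne'] at h

theorem transitionCurve_of_jacobi {a w : ℕ → ℝ} (ha : StrictMono a)
    (hat : Tendsto a atTop atTop) (hw : IsMathieuWeight w) {M : ℝ → ℝ → Matrix ℕ ℕ ℝ}
    (hM : ∀ d ε, (d, ε) ∈ transitionPoints M ↔ d ∈ jacobiEigenvalues a hw ε) (k : ℕ) :
    (∃ δ : ℝ → ℝ, IsTransitionCurve M k δ) ∧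
    ∀ δ : ℝ → ℝ, IsTransitionCurve M k δ →
      Tendsto (fun ε => δ ε / ε) atTop (𝓝 (-1)) ∧ Tendsto (fun ε => δ ε / ε) atBot (𝓝 1) := by
  constructor
  · choose δ hδ hk using fun ε => exists_mem_encard_lt_eq (infinite_jacobiEigenvalues ha hat hw ε)
      (finite_jacobiEigenvalues_inter_Iic ha hat hw ε) k
    refine ⟨δ, fun ε => ⟨(hM _ _).2 (hδ ε), ?_⟩⟩
    simp only [hM]
    exact hk ε
  · intro δ hδ
    have hlow : ∀ ε, a 0 - |ε| ≤ δ ε := fun ε => by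
      obtain ⟨f, hf0, hf⟩ := (hM _ _).1 (hδ ε).1
      exact hf.lower_bound hf0 fun n => ha.monotone (Nat.zero_le n)
    have hup : ∀ q : ℕ, ∃ C, ∀ ε, δ ε ≤ C - |ε| * (q / (q + 1)) := by
      intro q
      -- With `k + 1` blocks, a larger `δ ε` would have `k + 1` eigenvalues strictly below it, but
      -- curve `k` has exactly `k`.
      refine ⟨a ((k + 1) * (q + 2)), fun ε => ?_⟩
      by_contra! hlt
      have h1 := le_encard_jacobiEigenvalues_inter_Iic ha hat hw |ε| (k + 1) q
      have h2 := (hδ ε).2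
      simp only [hM] at h2
      rw [jacobiEigenvalues_abs] at h1
      have h3 := h1.trans (Set.encard_le_encard
        (t := {d | d < δ ε ∧ d ∈ jacobiEigenvalues a hw ε}) fun d hd =>
          ⟨lt_of_le_of_lt hd.2 hlt, hd.1⟩)
      rw [h2] at h3
      have h4 : k + 1 ≤ k := by exact_mod_cast h3
      omega
    constructor
    · refine (tendsto_div_neg_one tendsto_abs_atTop_atTop hlow hup).congr' ?_
      filter_upwards [eventually_ge_atTop 0] with ε hε
      rw [abs_of_nonneg hε]
    · have h := (tendsto_div_neg_one tendsto_abs_atBot_atTop hlow hup).neg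
      rw [neg_neg] at h
      refine h.congr' ?_
      filter_upwards [eventually_le_atBot 0] with ε hε
      rw [abs_of_nonpos hε, div_neg, neg_neg]

/-! ### The two Mathieu matrices as Jacobi operators -/

theorem tsum_tridiagonal_zero {r c : ℕ → ℝ} (hr : ∀ j, 1 < j → r j = 0) :
    ∑' j, r j * c j = r 0 * c 0 + r 1 * c 1 := by
  rw [tsum_eq_sum (s := Finset.range 2) fun j hj => by
    rw [hr j (by simp at hj; omega), zero_mul]]
  simp [Finset.sum_range_succ]

theorem tsum_tridiagonal_succ {r c : ℕ → ℝ} {i : ℕ} (hr : ∀ j, j < i ∨ i + 2 < j → r j = 0) :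
    ∑' j, r j * c j = r i * c i + r (i + 1) * c (i + 1) + r (i + 2) * c (i + 2) := by
  rw [tsum_eq_sum (s := Finset.range (i + 3)) fun j hj => by
    rw [hr j (by simp at hj; omega), zero_mul]]
  rw [Finset.sum_range_succ, Finset.sum_range_succ, Finset.sum_range_succ,
    Finset.sum_eq_zero fun j hj => by rw [hr j (Or.inl (Finset.mem_range.1 hj)), zero_mul],
    zero_add]

theorem isMathieuWeight_half : IsMathieuWeight fun _ => 1 / 2 :=
  ⟨by norm_num, by norm_num, fun _ => rfl⟩

/-- The first weight is the geometric mean of the unequal entries `1/2` and `1` of Version 1 (after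
removing `ε`), and it attains the bound `w₀² = 1/2`. -/
theorem isMathieuWeight_sqrt : IsMathieuWeight fun n => if n = 0 then (√2)⁻¹ else 1 / 2 :=
  ⟨by simp, by simp, fun n => by simp⟩

theorem mem_transitionPoints_mathieuTwo (lam : ℕ → ℝ) (d ε : ℝ) :
    (d, ε) ∈ transitionPoints (mathieuTwo lam) ↔
      d ∈ jacobiEigenvalues (fun n => lam (n + 1)) isMathieuWeight_half ε := by
  refine exists_congr fun c => and_congr Iff.rfl (forall_congr' fun i => ?_)
  have e : ∑' j, mathieuTwo lam d ε i j * c j =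
      (d - lam (i + 1)) * c i + ε * freeJacobi isMathieuWeight_half c i := by
    cases i with
    | zero =>
      rw [tsum_tridiagonal_zero fun j hj => by
        rw [mathieuTwo, if_neg (by omega), if_neg (by omega)]]
      simp [mathieuTwo]; ring
    | succ i =>
      rw [tsum_tridiagonal_succ (i := i) fun j hj => by
        rw [mathieuTwo, if_neg (by omega), if_neg (by omega)]]
      simp [mathieuTwo]; ring
  simp only [e]

theorem tsum_mathieuOne_zero (lam : ℕ → ℝ) (d ε : ℝ) (c : ℕ → ℝ) :
    ∑' j, mathieuOne lam d ε 0 j * c j = (d - lam 0) * c 0 + ε / 2 * c 1 := by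
  rw [tsum_tridiagonal_zero fun j hj => by
    rw [mathieuOne, if_neg (by omega), if_neg (by omega), if_neg (by omega)]]
  simp [mathieuOne]

theorem tsum_mathieuOne_succ (lam : ℕ → ℝ) (d ε : ℝ) (c : ℕ → ℝ) (i : ℕ) :
    ∑' j, mathieuOne lam d ε (i + 1) j * c j =
      (if i = 0 then ε else ε / 2) * c i + (d - lam (i + 1)) * c (i + 1) + ε / 2 * c (i + 2) := by
  rw [tsum_tridiagonal_succ (i := i) fun j hj => by
    rw [mathieuOne, if_neg (by omega), if_neg (by omega), if_neg (by omega)]]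
  simp [mathieuOne]
  omega

/-- Rescaling the zeroth coordinate by `√2` makes the matrix of Version 1 symmetric. -/
theorem mem_transitionPoints_mathieuOne (lam : ℕ → ℝ) (d ε : ℝ) :
    (d, ε) ∈ transitionPoints (mathieuOne lam) ↔
      d ∈ jacobiEigenvalues lam isMathieuWeight_sqrt ε := by
  have h2 : √2 * √2 = 2 := Real.mul_self_sqrt (by norm_num)
  have h3 : (√2)⁻¹ * (√2)⁻¹ = 1 / 2 := by rw [← mul_inv, h2]; norm_num
  have h1 : (1 : ℝ) ≤ √2 := Real.one_le_sqrt.2 (by norm_num)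
  constructor
  · rintro ⟨c, hc0, hc⟩
    let T := weightedComp (fun n => if n = 0 then √2 else 1) √2
      (fun n => by split_ifs <;> simp [abs_of_nonneg, h1]) id Function.injective_id
    refine ⟨T c, fun h => hc0 ?_, fun n => ?_⟩
    · ext n
      have hn : T c n = 0 := by rw [h]; rfl
      simp only [T, weightedComp_apply, id] at hn
      refine (mul_eq_zero.1 hn).resolve_left ?_
      split_ifs <;> simp
    · have hn := hc n
      cases n with
      | zero =>
        rw [tsum_mathieuOne_zero] at hn
        simp only [freeJacobi_apply_zero, T, weightedComp_apply, id, if_true, one_ne_zero, if_false]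
        field_simp
        linear_combination 2 * hn + (d - lam 0) * c 0 * h2
      | succ n =>
        rw [tsum_mathieuOne_succ] at hn
        simp only [freeJacobi_apply_succ, T, weightedComp_apply, id, Nat.succ_ne_zero, if_false]
        split_ifs at hn ⊢ with h
        · field_simp
          linear_combination 2 * hn
        · linear_combination hn
  · rintro ⟨f, hf0, hf⟩
    let T := weightedComp (fun n => if n = 0 then (√2)⁻¹ else 1) 1
      (fun n => by split_ifs <;> simp [abs_of_nonneg, inv_le_one_of_one_le₀, h1]) id
      Function.injective_id
    refine ⟨T f, fun h => hf0 ?_, fun n => ?_⟩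
    · ext n
      have hn : T f n = 0 := by rw [h]; rfl
      simp only [T, weightedComp_apply, id] at hn
      refine (mul_eq_zero.1 hn).resolve_left ?_
      split_ifs <;> simp
    · have hn := hf n
      cases n with
      | zero =>
        rw [tsum_mathieuOne_zero]
        simp only [freeJacobi_apply_zero, T, weightedComp_apply, id, if_true, one_ne_zero,
          if_false] at hn ⊢
        linear_combination (√2)⁻¹ * hn - ε * f 1 * h3
      | succ n =>
        rw [tsum_mathieuOne_succ]
        simp only [freeJacobi_apply_succ, T, weightedComp_apply, id, Nat.succ_ne_zero,
          if_false] at hn ⊢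
        split_ifs at hn ⊢ with h
        · linear_combination hn
        · linear_combination hn

theorem proposition7p1
    (κ : ℕ → Fin 3) (m₀ : ℤ) (s : ℝ) (hs : s = 5 ∨ s = 6)
    (φ : Plane → ℝ) (hφ : IsLatticeEigenfunction κ m₀ φ s)
    (hφ0 : ∃ x ∈ latticeVertices κ m₀, φ x ≠ 0)
    (lam : ℕ → ℝ) (hmono : StrictMono lam)
    (hlam : Set.range lam = decimationEigenvalues κ m₀ s φ ∨
      Set.range lam = insert 0 (decimationEigenvalues κ m₀ s φ))
    (M : ℝ → ℝ → Matrix ℕ ℕ ℝ) (hM : M = mathieuOne lam ∨ M = mathieuTwo lam) (k : ℕ) :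
    (∃ δ : ℝ → ℝ, IsTransitionCurve M k δ) ∧
    ∀ δ : ℝ → ℝ, IsTransitionCurve M k δ →
      Filter.Tendsto (fun ε => δ ε / ε) Filter.atTop (nhds (-1)) ∧
      Filter.Tendsto (fun ε => δ ε / ε) Filter.atBot (nhds 1) := by
  have hsub : ∀ n, lam n ∈ insert 0 (decimationEigenvalues κ m₀ s φ) := fun n => by
    have hn := mem_range_self (f := lam) n
    rcases hlam with h | h <;> rw [h] at hn
    · exact mem_insert_of_mem 0 hn
    · exact hn
  -- Adjoining `0` to the spectrum keeps its lower sections finite, so both enumerations are treated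
  -- at once.
  have htop : Tendsto lam atTop atTop :=
    tendsto_atTop_of_finite_inter_Iic (S := insert 0 (decimationEigenvalues κ m₀ s φ))
      (fun C => ((finite_decimationEigenvalues_inter_Iic κ m₀ hs φ C).insert 0).subset (by
        rintro x ⟨rfl | hx, hC⟩
        · exact mem_insert _ _
        · exact mem_insert_of_mem _ ⟨hx, hC⟩)) hmono hsub
  rcases hM with rfl | rfl
  · exact transitionCurve_of_jacobi hmono htop isMathieuWeight_sqrt
      (mem_transitionPoints_mathieuOne lam) k
  · exact transitionCurve_of_jacobi (fun i j h => hmono (Nat.succ_lt_succ h))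
      ((tendsto_add_atTop_iff_nat 1).2 htop) isMathieuWeight_half
      (mem_transitionPoints_mathieuTwo lam) k
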